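/- All graphs are finite, undirected and simple. A graph $M$ is a minor of a graph $G$ if there are pairwise vertex-disjoint connected (in particular non-empty) subgraphs $H_x$ of $G$, one for each vertex $x$ of $M$, such that for every edge $xy$ of $M$ some edge of $G$ joins a vertex of $H_x$ to a vertex of $H_y$. For a linear order $L$ of $V(G)$, a vertex $v$ and an integer $r\ge 1$, let $\mathrm{SReach}_r[G,L,v]$ be the set of all vertices $u\le_L v$ for which there is a path of length at most $r$ in $G$ between $u$ and $v$ (possibly of length $0$) all of whose inner vertices $w$ satisfy $v<_L w$. The $r$-colouring number of $G$ is $$\mathrm{col}_r(G)=\min_{L}\ \max_{v\in V(G)}\ \bigl|\mathrm{SReach}_r[G,L,v]\bigr|,$$ where $L$ runs over all linear orders of $V(G)$ and the maximum is $0$ if $V(G)=\emptyset$. **Corollary 1.3.** Let $t\ge 3$ and $r\ge 1$ be integers. Every graph $G$ that does not have the complete graph $K_t$ as a minor satisfies $$\mathrm{col}_r(G)\ \le\ \binom{t-1}{2}\,(2r+1).$$ -/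

import Mathlib

/-- `M` is a minor of `G`: there are pairwise vertex-disjoint connected (hence non-empty)
subgraphs `H i` of `G`, one for each vertex `i` of `M`, such that for every edge `ij` of `M`
some edge of `G` joins `H i` to `H j`. -/
def SimpleGraph.IsMinorOf {W V : Type*} (M : SimpleGraph W) (G : SimpleGraph V) : Prop :=
  ∃ H : W → G.Subgraph,
    (∀ i, (H i).Connected) ∧
    (∀ i j, i ≠ j → Disjoint (H i).verts (H j).verts) ∧
    ∀ i j, M.Adj i j → ∃ u ∈ (H i).verts, ∃ v ∈ (H j).verts, G.Adj u v

/-- The set of vertices strongly `r`-reachable from `v` with respect to the linear order `L`: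
those `u ≤ v` joined to `v` by a path of length at most `r` all of whose inner vertices
(the vertices of the path other than its two ends) are greater than `v`. -/
def SimpleGraph.strongReach {V : Type*} (G : SimpleGraph V) (L : LinearOrder V) (r : ℕ) (v : V) :
    Set V :=
  {u | L.le u v ∧ ∃ p : G.Walk v u, p.IsPath ∧ p.length ≤ r ∧
    ∀ w ∈ p.support, w ≠ v → w ≠ u → L.lt v w}

/-- The `r`-colouring number of a finite graph `G`: the minimum over all linear orders `L` of the
vertices of the maximum over all vertices `v` of the number of vertices strongly `r`-reachable
from `v` with respect to `L` (the maximum over the empty vertex set is `0`). -/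
noncomputable def SimpleGraph.colouringNumber {V : Type*} [Fintype V] (G : SimpleGraph V)
    (r : ℕ) : ℕ :=
  ⨅ L : LinearOrder V, Finset.univ.sup fun v : V => (G.strongReach L r v).ncard

/-!
The vertices are ordered from first to last, and the connected pieces `C` of what is not yet ordered
are treated separately, as in Andreae's strategy for the pursuit game on graphs excluding a minor.
Write `n = t - 1`. For each territory `C` a minor model of a graph on at most `n` vertices is kept
outside `C` (`GuardedModel`). Its branch sets and linking paths cover the boundary of `C`; a branch
set has at most one vertex on the boundary, and each linking path is part of a path that was
shortest in a region containing `C`, so that a vertex of `C` reaches at most `2 * r + 1` of its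
vertices within distance `r` through `C` (`geodesic_ball_ncard_le`). The boundary vertices in branch
sets are paid for by the paths on which they lie or by non-edges of the model. So a vertex of `C`
reaches at most `n.choose 2 * (2 * r + 1)` boundary vertices (`GuardedModel.ncard_reach_le`).

When the territory shrinks, branch sets can lose contact with it. Such a branch set swallows a linking
path up to its first boundary vertex, or is discarded when no linking path at it meets the boundary
(`GuardedModel.exists_attached`). Once all branch sets are in contact with `C`, the model is extended
by a piece of `C`, which comes next in the order: a single vertex if fewer than `n` branch sets are
in use, and a shortest path through `C` between two branch sets that are not linked yet otherwise.
If neither is possible, the model is a complete graph on `n` vertices, and together with `C` it gives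
a `K_t` minor (`GuardedModel.isMinorOf_of_model_eq_top`). The new vertices are themselves counted by
the extended model, so they obey the same bound.
-/

open SimpleGraph

section Territory

variable {V : Type*}

/-! ### Short walks and shortest paths -/

/-- Some walk of length at most `r` from `x` to `u` has all its vertices, except possibly `u`,
in `C`. -/
def ReachThrough (G : SimpleGraph V) (C : Set V) (r : ℕ) (x u : V) : Prop :=
  ∃ p : G.Walk x u, p.length ≤ r ∧ ∀ w ∈ p.support, w ≠ u → w ∈ C

theorem ReachThrough.mono {G : SimpleGraph V} {C C' : Set V} {r : ℕ} {x u : V}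
    (h : ReachThrough G C r x u) (hC : C ⊆ C') : ReachThrough G C' r x u := by
  obtain ⟨p, hp, hs⟩ := h
  exact ⟨p, hp, fun w hw hne => hC (hs w hw hne)⟩

theorem ncard_le_of_injOn_of_spread {S : Set V} (hS : S.Finite) (f : V → ℕ) (k : ℕ)
    (hf : Set.InjOn f S) (h : ∀ u ∈ S, ∀ v ∈ S, f v ≤ f u + k) : S.ncard ≤ k + 1 := by
  rcases S.eq_empty_or_nonempty with rfl | hne
  · simp
  obtain ⟨a, ha, hmin⟩ := Set.exists_min_image S f hS hne
  have := Set.ncard_le_ncard_of_injOn (t := (Set.Icc (f a) (f a + k))) f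
    (fun u hu => ⟨hmin u hu, h a ha u hu⟩) hf (Set.finite_Icc _ _)
  have h2 : (Set.Icc (f a) (f a + k)).ncard = k + 1 := by
    rw [← Finset.coe_Icc, Set.ncard_coe_finset, Nat.card_Icc]; omega
  omega

/-- A ball of radius `r` meets a shortest path in at most `2 * r + 1` vertices: the positions on the
path of two vertices of the ball differ by at most `2 * r`. -/
theorem geodesic_ball_ncard_le {H : SimpleGraph V} {y z : V} (p : H.Walk y z)
    (hp : p.length = H.dist y z) (x : V) (r : ℕ) :
    {u | u ∈ p.support ∧ ∃ q : H.Walk x u, q.length ≤ r}.ncard ≤ 2 * r + 1 := by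
  classical
  have key : ∀ u (hu : u ∈ p.support),
      (p.takeUntil u hu).length + (p.dropUntil u hu).length = p.length := fun u hu => by
    rw [← Walk.length_append, p.take_spec hu]
  refine ncard_le_of_injOn_of_spread ((List.finite_toSet p.support).subset fun u hu => hu.1)
    (fun u => if hu : u ∈ p.support then (p.takeUntil u hu).length else 0) (2 * r) ?_ ?_
  · rintro u ⟨hu, -⟩ v ⟨hv, -⟩ huv
    simp only [hu, hv, dif_pos] at huv
    rw [← Walk.getVert_length_takeUntil hu, ← Walk.getVert_length_takeUntil hv, huv]
  · rintro u ⟨hu, q, hq⟩ v ⟨hv, q', hq'⟩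
    simp only [hu, hv, dif_pos]
    have h1 := dist_le ((p.takeUntil u hu).append (q.reverse.append (q'.append (p.dropUntil v hv))))
    simp only [Walk.length_append, Walk.length_reverse] at h1
    have := key v hv
    omega

/-! ### Connected sets and linking paths -/

/-- Any two vertices of `S` are joined by a walk inside `S`. The empty set qualifies. -/
def ConnIn (G : SimpleGraph V) (S : Set V) : Prop :=
  ∀ x ∈ S, ∀ y ∈ S, ∃ p : G.Walk x y, ∀ w ∈ p.support, w ∈ S

theorem connIn_empty (G : SimpleGraph V) : ConnIn G ∅ := fun _ h => h.elim

theorem connIn_singleton (G : SimpleGraph V) (v : V) : ConnIn G {v} := by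
  rintro _ rfl _ rfl
  exact ⟨Walk.nil, by simp⟩

/-- A set is connected if it can be walked from everywhere to a connected subset of it. -/
theorem ConnIn.of_base {G : SimpleGraph V} {B S : Set V} (hB : ConnIn G B) (hBS : B ⊆ S)
    (h : ∀ x ∈ S, ∃ b ∈ B, ∃ p : G.Walk x b, ∀ w ∈ p.support, w ∈ S) : ConnIn G S := by
  intro x hx y hy
  obtain ⟨b, hb, p, hp⟩ := h x hx
  obtain ⟨c, hc, q, hq⟩ := h y hy
  obtain ⟨m, hm⟩ := hB b hb c hc
  refine ⟨p.append (m.append q.reverse), fun w hw => ?_⟩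
  simp only [Walk.mem_support_append_iff, Walk.support_reverse, List.mem_reverse] at hw
  rcases hw with hw | hw | hw
  exacts [hp w hw, hBS (hm w hw), hq w hw]

theorem ConnIn.subgraph_connected {G : SimpleGraph V} {S : Set V} (h : ConnIn G S)
    (hne : S.Nonempty) : ((⊤ : G.Subgraph).induce S).Connected := by
  rw [← connected_induce_iff]
  have : Nonempty S := hne.to_subtype
  refine ⟨fun x y => ?_⟩
  obtain ⟨p, hp⟩ := h x x.2 y y.2
  exact ⟨p.induce S hp⟩

theorem exists_walk_of_isChain {G : SimpleGraph V} {S : Set V} (l : List V) : ∀ (a : V),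
    List.IsChain G.Adj (a :: l) → (∀ w ∈ a :: l, w ∈ S) →
    ∀ x ∈ a :: l, ∃ p : G.Walk x a, ∀ w ∈ p.support, w ∈ S := by
  induction l with
  | nil =>
    intro a _ hS x hx
    obtain rfl : x = a := by simpa using hx
    exact ⟨Walk.nil, by simpa using hS⟩
  | cons b l ih =>
    intro a hc hS x hx
    rcases List.mem_cons.1 hx with rfl | hx
    · exact ⟨Walk.nil, by simpa using hS x (by simp)⟩
    · rw [List.isChain_cons_cons] at hc
      obtain ⟨p, hp⟩ := ih b hc.2 (fun w hw => hS w (List.mem_cons_of_mem _ hw)) x hx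
      refine ⟨p.concat hc.1.symm, fun w hw => ?_⟩
      rw [Walk.support_concat] at hw
      simp only [List.mem_append, List.mem_singleton] at hw
      rcases hw with hw | rfl
      · exact hp w hw
      · exact hS _ (by simp)

/-- Some path from `A` to `B` has `P` as the set of its inner vertices. The list of inner vertices is
duplicate-free, but its disjointness from `A` and `B` is not required; `P = ∅` means that an edge
joins `A` to `B`. -/
def Linked (G : SimpleGraph V) (A B P : Set V) : Prop :=
  ∃ a ∈ A, ∃ b ∈ B, ∃ l : List V, l.Nodup ∧ P = {w | w ∈ l} ∧ List.IsChain G.Adj (a :: (l ++ [b]))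

theorem Linked.mono {G : SimpleGraph V} {A A' B B' P : Set V} (h : Linked G A B P) (hA : A ⊆ A')
    (hB : B ⊆ B') : Linked G A' B' P := by
  obtain ⟨a, ha, b, hb, l, h⟩ := h
  exact ⟨a, hA ha, b, hB hb, l, h⟩

theorem Linked.symm {G : SimpleGraph V} {A B P : Set V} (h : Linked G A B P) : Linked G B A P := by
  obtain ⟨a, ha, b, hb, l, hl, rfl, hc⟩ := h
  refine ⟨b, hb, a, ha, l.reverse, by simpa using hl, by simp, ?_⟩
  have : b :: (l.reverse ++ [a]) = (a :: (l ++ [b])).reverse := by simp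
  rw [this, List.isChain_reverse]
  exact hc.imp fun _ _ h => h.symm

theorem Linked.exists_walk {G : SimpleGraph V} {A B P S : Set V} (h : Linked G A B P)
    (hA : A ⊆ S) (hP : P ⊆ S) : ∀ x ∈ P, ∃ a ∈ A, ∃ p : G.Walk x a, ∀ w ∈ p.support, w ∈ S := by
  obtain ⟨a, ha, b, hb, l, hl, rfl, hc⟩ := h
  intro x hx
  refine ⟨a, ha, exists_walk_of_isChain l a ?_ ?_ x (List.mem_cons_of_mem _ hx)⟩
  · rw [← List.cons_append, List.isChain_append] at hc
    exact hc.1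
  · intro w hw
    rcases List.mem_cons.1 hw with rfl | hw
    exacts [hA ha, hP hw]

theorem Linked.exists_adj {G : SimpleGraph V} {A B P : Set V} (h : Linked G A B P) :
    ∃ u ∈ A ∪ P, ∃ b ∈ B, G.Adj u b := by
  obtain ⟨a, ha, b, hb, l, hl, rfl, hc⟩ := h
  rw [← List.cons_append, List.isChain_append] at hc
  have := hc.2.2 ((a :: l).getLast (by simp)) (List.getLast_mem_getLast? (by simp)) b (by simp)
  refine ⟨_, ?_, b, hb, this⟩
  rcases List.mem_cons.1 (List.getLast_mem (l := a :: l) (by simp)) with h | h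
  · left; rw [h]; exact ha
  · right; exact h

theorem List.exists_append_first {α : Type*} (p : α → Prop) (l : List α) (h : ∃ x ∈ l, p x) :
    ∃ l₁ y l₂, l = l₁ ++ y :: l₂ ∧ p y ∧ ∀ w ∈ l₁, ¬ p w := by
  induction l with
  | nil => simp at h
  | cons a l ih =>
    by_cases ha : p a
    · exact ⟨[], a, l, rfl, ha, by simp⟩
    · obtain ⟨l₁, y, l₂, rfl, hy, hw⟩ := ih (by
        obtain ⟨x, hx, hp⟩ := h
        rcases List.mem_cons.1 hx with rfl | hx
        exacts [(ha hp).elim, ⟨x, hx, hp⟩])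
      exact ⟨a :: l₁, y, l₂, rfl, hy, by simpa [ha] using hw⟩

/-- Moving into `A` the initial segment of a linking path that ends at its first vertex in `N` gives
`A` exactly one new vertex of `N`, and the rest of the path still links the enlarged set to `B`. -/
theorem Linked.absorb {G : SimpleGraph V} {A B P N : Set V} (h : Linked G A B P)
    (hA : ConnIn G A) (hN : (P ∩ N).Nonempty) :
    ∃ P₁ P₂ y, P₁ ⊆ P ∧ P₂ ⊆ P ∧ Disjoint P₁ P₂ ∧ P ⊆ P₁ ∪ P₂ ∧ P₁ ∩ N = {y} ∧
      ConnIn G (A ∪ P₁) ∧ Linked G (A ∪ P₁) B P₂ := by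
  obtain ⟨a, ha, b, hb, l, hl, rfl, hc⟩ := h
  obtain ⟨l₁, y, l₂, rfl, hy, hw⟩ := List.exists_append_first (· ∈ N) l hN
  have hnd := List.nodup_append.1 hl
  have hnd2 := List.nodup_cons.1 hnd.2.1
  have hc1 : List.IsChain G.Adj (a :: (l₁ ++ [y])) ∧ List.IsChain G.Adj (y :: (l₂ ++ [b])) := by
    cases l₂ with
    | nil =>
      have : a :: (l₁ ++ [y] ++ [b]) = a :: (l₁ ++ y :: b :: []) := by simp
      rw [this, List.isChain_cons_append_cons_cons] at hc
      simpa using ⟨hc.1, hc.2.1⟩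
    | cons c l₂ =>
      have : a :: (l₁ ++ y :: c :: l₂ ++ [b]) = a :: (l₁ ++ y :: c :: (l₂ ++ [b])) := by simp
      rw [this, List.isChain_cons_append_cons_cons] at hc
      exact ⟨hc.1, by simpa using ⟨hc.2.1, hc.2.2⟩⟩
  have hlink : Linked G A {y} {w | w ∈ l₁} := ⟨a, ha, y, rfl, l₁, hnd.1, rfl, hc1.1⟩
  refine ⟨{w | w ∈ l₁ ++ [y]}, {w | w ∈ l₂}, y, ?_, ?_, ?_, ?_, ?_, ?_, ?_⟩
  · intro w hw
    simp only [Set.mem_ofPred_eq, List.mem_append, List.mem_cons] at hw ⊢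
    tauto
  · intro w hw
    simp only [Set.mem_ofPred_eq, List.mem_append, List.mem_cons] at hw ⊢
    tauto
  · rw [Set.disjoint_left]
    intro w hw hw2
    simp only [Set.mem_ofPred_eq, List.mem_append, List.mem_singleton] at hw hw2
    rcases hw with hw | rfl
    · exact hnd.2.2 w hw w (List.mem_cons_of_mem _ hw2) rfl
    · exact hnd2.1 hw2
  · intro w hw
    simp only [Set.mem_ofPred_eq, List.mem_append, List.mem_cons,
      Set.mem_union] at hw ⊢
    tauto
  · ext w
    simp only [Set.mem_inter_iff, Set.mem_ofPred_eq, List.mem_append, List.mem_singleton,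
      Set.mem_singleton_iff]
    constructor
    · rintro ⟨h | h, hN⟩
      exacts [(hw w h hN).elim, h]
    · rintro rfl
      exact ⟨Or.inr rfl, hy⟩
  · refine hA.of_base Set.subset_union_left ?_
    rintro x (hx | hx)
    · obtain ⟨p, hp⟩ := hA x hx x hx
      exact ⟨x, hx, p, fun w hw => Or.inl (hp w hw)⟩
    · refine ⟨a, ha, exists_walk_of_isChain _ a hc1.1 ?_ x (List.mem_cons_of_mem _ hx)⟩
      intro w hw
      rcases List.mem_cons.1 hw with rfl | hw
      exacts [Or.inl ha, Or.inr hw]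
  · exact ⟨y, Or.inr (by simp), b, hb, l₂, hnd2.2, rfl, hc1.2⟩

/-- Two vertices with neighbours in the connected set `C` are joined by a path through `C`, not using
a possible edge between them, of which every `x ∈ C` reaches at most `2 * r + 1` vertices by walks
of length at most `r` through `C`. -/
theorem exists_geodesic_through {G : SimpleGraph V} {C : Set V} (hC : ConnIn G C) {y z : V}
    (hy : y ∉ C) (hz : z ∉ C) (hyz : y ≠ z) (hyC : ∃ c ∈ C, G.Adj y c) (hzC : ∃ c ∈ C, G.Adj z c)
    (r : ℕ) :
    ∃ l : List V, l ≠ [] ∧ l.Nodup ∧ (∀ w ∈ l, w ∈ C) ∧ List.IsChain G.Adj (y :: (l ++ [z])) ∧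
      ∀ x ∈ C, {u | u ∈ y :: (l ++ [z]) ∧ ReachThrough G C r x u}.ncard ≤ 2 * r + 1 := by
  obtain ⟨c, hc, hyc⟩ := hyC
  obtain ⟨d, hd, hzd⟩ := hzC
  let C' : Set V := insert y (insert z C)
  have hCC' : C ⊆ C' := fun w hw => Or.inr (Or.inr hw)
  -- In `H` the edge `y z` is missing, so that a shortest path from `y` to `z` runs through `C`, while
  -- walks of `G` through `C` that end in `C'` survive.
  let H : SimpleGraph V :=
    { Adj := fun u v => G.Adj u v ∧ (u ∈ C ∨ v ∈ C) ∧ u ∈ C' ∧ v ∈ C'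
      symm := ⟨fun u v h => ⟨h.1.symm, h.2.1.symm, h.2.2.2, h.2.2.1⟩⟩
      loopless := ⟨fun u h => G.loopless.irrefl u h.1⟩ }
  have lift : ∀ {x u : V} (q : G.Walk x u), u ∈ C' → x ∈ C → (∀ w ∈ q.support, w ≠ u → w ∈ C) →
      ∃ q' : H.Walk x u, q'.length ≤ q.length := by
    intro x u q hu
    induction q with
    | nil => exact fun _ _ => ⟨Walk.nil, le_rfl⟩
    | @cons a b u hab q ih =>
      intro ha hs
      by_cases hb : b = u
      · subst hb
        exact ⟨Walk.cons (⟨hab, Or.inl ha, hCC' ha, hu⟩ : H.Adj a b) Walk.nil, by simp⟩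
      · have hbC : b ∈ C := hs b (by simp) hb
        obtain ⟨q', hq'⟩ := ih hu hbC fun w hw hne => hs w (by simp [hw]) hne
        exact ⟨Walk.cons (⟨hab, Or.inl ha, hCC' ha, hCC' hbC⟩ : H.Adj a b) q', by simpa using hq'⟩
  have hreach : H.Reachable y z := by
    obtain ⟨m, hm⟩ := hC c hc d hd
    obtain ⟨m', -⟩ := lift m (hCC' hd) hc fun w hw _ => hm w hw
    exact ⟨Walk.cons (⟨hyc, Or.inr hc, Or.inl rfl, hCC' hc⟩ : H.Adj y c)
      (m'.concat (⟨hzd.symm, Or.inl hd, hCC' hd, Or.inr (Or.inl rfl)⟩ : H.Adj d z))⟩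
  obtain ⟨p, hp⟩ := hreach.exists_walk_length_eq_dist
  have hpath := p.isPath_of_length_eq_dist hp
  have hsub : ∀ w ∈ p.support, w ∈ C' := by
    intro w hw
    obtain ⟨b, hb⟩ : ∃ b, H.Adj w b := by
      rcases eq_or_ne w z with rfl | hwz
      · exact ⟨d, hzd, Or.inr hd, Or.inr (Or.inl rfl), hCC' hd⟩
      · classical
        have hnil : ¬ (p.dropUntil w hw).Nil := Walk.not_nil_of_ne hwz
        exact ⟨_, Walk.adj_snd hnil⟩
    exact hb.2.2.1
  have hball := geodesic_ball_ncard_le p hp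
  have hchain := p.isChain_adj_support
  obtain ⟨l, hl⟩ : ∃ l, p.support = y :: (l ++ [z]) := by
    cases p with
    | nil => exact (hyz rfl).elim
    | cons h q =>
      refine ⟨q.support.dropLast, ?_⟩
      rw [Walk.support_cons]
      congr 1
      conv_lhs => rw [← List.dropLast_append_getLast q.support_ne_nil]
      rw [Walk.getLast_support]
  have hnd := hpath.support_nodup
  rw [hl] at hnd hchain hsub hball
  simp only [List.nodup_cons, List.mem_append, List.mem_singleton, not_or,
    List.nodup_append] at hnd
  refine ⟨l, ?_, hnd.2.1, ?_, hchain.imp fun _ _ h => h.1, ?_⟩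
  · rintro rfl
    simp only [List.nil_append, List.isChain_cons_cons, List.isChain_singleton, and_true] at hchain
    rcases hchain.2.1 with h | h
    exacts [hy h, hz h]
  · intro w hw
    rcases hsub w (by simp [hw]) with rfl | rfl | h
    · exact (hnd.1.1 hw).elim
    · exact (hnd.2.2.2 w hw w rfl rfl).elim
    · exact h
  · intro x hx
    refine (Set.ncard_le_ncard ?_ ?_).trans (hball x r)
    · rintro u ⟨hu, q, hq, hs⟩
      obtain ⟨q', hq'⟩ := lift q (hsub u hu) hx hs
      exact ⟨hu, q', hq'.trans hq⟩
    · exact (List.finite_toSet (y :: (l ++ [z]))).subset fun u hu => hu.1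

/-! ### Guarded models of minors -/

/-- A minor model in `G` of a graph `model` on a subset of `Fin n`, in subdivided form. The vertex `i`
is represented by the connected set `branch i`, where `branch i = ∅` means that `i` is not in use;
the edge `e` by a path with inner vertices `link e`. All these sets are pairwise disjoint and avoid
the territory `D`. They cover the set `N`, which stands for the outer boundary of `D`.

Every branch set contains at most one vertex of `N`. The part of `link e` in `N` lies in `guard e`,
and no `x ∈ R` reaches more than `2 * r + 1` vertices of `guard e` by walks of length at most `r`
through `R`. The vertex of `N` in `branch i` lies in the guard of an edge at `i`, unless `i` has a
non-neighbour, used or not. Thus `N` can be distributed over the `n.choose 2` pairs of vertices: an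
edge receives part of its guard and a non-edge at most one vertex from each of its two ends.

The values of `link` and `guard` outside the edge set are irrelevant. The region `R` is separate
from `D` so that vertices leaving the territory can be counted by the model obtained after they
have left. -/
structure GuardedModel (G : SimpleGraph V) (r n : ℕ) (R N D : Set V) where
  branch : Fin n → Set V
  model : SimpleGraph (Fin n)
  link : Sym2 (Fin n) → Set V
  guard : Sym2 (Fin n) → Set V
  conn : ∀ i, ConnIn G (branch i)
  disjoint_branch : ∀ i j, i ≠ j → Disjoint (branch i) (branch j)
  disjoint_branch_link : ∀ i, ∀ e ∈ model.edgeSet, Disjoint (branch i) (link e)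
  disjoint_link : ∀ e ∈ model.edgeSet, ∀ e' ∈ model.edgeSet, e ≠ e' → Disjoint (link e) (link e')
  branch_disjoint : ∀ i, Disjoint (branch i) D
  link_disjoint : ∀ e ∈ model.edgeSet, Disjoint (link e) D
  linked : ∀ i j, model.Adj i j → Linked G (branch i) (branch j) (link s(i, j))
  branch_subsingleton : ∀ i, (branch i ∩ N).Subsingleton
  cover : ∀ u ∈ N, (∃ i, u ∈ branch i) ∨ ∃ e ∈ model.edgeSet, u ∈ link e
  link_guard : ∀ e ∈ model.edgeSet, link e ∩ N ⊆ guard e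
  branch_guard : ∀ i, ∀ y ∈ branch i ∩ N,
    (∃ j, j ≠ i ∧ ¬ model.Adj i j) ∨ ∃ j, model.Adj i j ∧ y ∈ guard s(i, j)
  spread : ∀ e ∈ model.edgeSet, ∀ x ∈ R, {u | u ∈ guard e ∧ ReachThrough G R r x u}.ncard ≤ 2 * r + 1

namespace GuardedModel

variable {G : SimpleGraph V} {r n : ℕ} {R N D : Set V}

/-- The same model for a smaller region, boundary and territory. -/
def mono [Finite V] (W : GuardedModel G r n R N D) {R' N' D' : Set V} (hR : R' ⊆ R) (hN : N' ⊆ N)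
    (hD : D' ⊆ D) : GuardedModel G r n R' N' D' where
  branch := W.branch
  model := W.model
  link := W.link
  guard := W.guard
  conn := W.conn
  disjoint_branch := W.disjoint_branch
  disjoint_branch_link := W.disjoint_branch_link
  disjoint_link := W.disjoint_link
  branch_disjoint i := (W.branch_disjoint i).mono_right hD
  link_disjoint e he := (W.link_disjoint e he).mono_right hD
  linked := W.linked
  branch_subsingleton i := (W.branch_subsingleton i).anti (Set.inter_subset_inter_right _ hN)
  cover u hu := W.cover u (hN hu)
  link_guard e he := (Set.inter_subset_inter_right _ hN).trans (W.link_guard e he)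
  branch_guard i y hy := W.branch_guard i y ⟨hy.1, hN hy.2⟩
  spread e he x hx := by
    refine le_trans (Set.ncard_le_ncard ?_ (Set.toFinite _)) (W.spread e he x (hR hx))
    exact fun u hu => ⟨hu.1, hu.2.mono hR⟩

/-- The model using no vertices. -/
def empty (G : SimpleGraph V) (r n : ℕ) (R D : Set V) : GuardedModel G r n R ∅ D where
  branch _ := ∅
  model := ⊥
  link _ := ∅
  guard _ := ∅
  conn _ := connIn_empty G
  disjoint_branch := by simp
  disjoint_branch_link := by simp
  disjoint_link := by simp
  branch_disjoint := by simp
  link_disjoint := by simp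
  linked := by simp
  branch_subsingleton := by simp
  cover := by simp
  link_guard := by simp
  branch_guard := by simp
  spread := by simp

theorem branch_nonempty (W : GuardedModel G r n R N D) {i j : Fin n} (h : W.model.Adj i j) :
    (W.branch i).Nonempty := by
  obtain ⟨a, ha, -⟩ := W.linked i j h
  exact ⟨a, ha⟩

/-- The number of vertices of `N` reachable from a vertex of `R` is at most `2 * r + 1` for each pair
of vertices of the model; a non-edge pays for at most two vertices. -/
theorem ncard_reach_le [Finite V] (hr : 1 ≤ r) (W : GuardedModel G r n R N D) {x : V}
    (hx : x ∈ R) : {u | u ∈ N ∧ ReachThrough G R r x u}.ncard ≤ n.choose 2 * (2 * r + 1) := by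
  classical
  have := Fintype.ofFinite V
  -- `T e` is the share of `N` charged to the pair `e`.
  let T : Sym2 (Fin n) → Set V := fun e =>
    if e ∈ W.model.edgeSet then {u | u ∈ W.guard e ∧ ReachThrough G R r x u}
    else {u | u ∈ N ∧ ∃ i ∈ e, u ∈ W.branch i}
  have hT : ∀ e ∈ (⊤ : SimpleGraph (Fin n)).edgeFinset, (T e).toFinset.card ≤ 2 * r + 1 := by
    intro e _
    rw [← Set.ncard_eq_toFinset_card']
    simp only [T]
    split_ifs with he
    · exact W.spread e he x hx
    · induction e using Sym2.ind with
      | _ i j =>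
        have h1 := Set.ncard_le_one_iff_subsingleton.2 (W.branch_subsingleton i)
        have h2 := Set.ncard_le_one_iff_subsingleton.2 (W.branch_subsingleton j)
        have h3 := Set.ncard_union_le (W.branch i ∩ N) (W.branch j ∩ N)
        have h4 : {u | u ∈ N ∧ ∃ k ∈ s(i, j), u ∈ W.branch k} ⊆
            (W.branch i ∩ N) ∪ (W.branch j ∩ N) := by
          rintro u ⟨hu, k, hk, huk⟩
          rcases Sym2.mem_iff.1 hk with rfl | rfl
          exacts [Or.inl ⟨huk, hu⟩, Or.inr ⟨huk, hu⟩]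
        have h5 := Set.ncard_le_ncard h4 (Set.toFinite _)
        omega
  have hsub : {u | u ∈ N ∧ ReachThrough G R r x u} ⊆
      ((⊤ : SimpleGraph (Fin n)).edgeFinset.biUnion fun e => (T e).toFinset : Finset V) := by
    rintro u ⟨hu, hreach⟩
    simp only [Finset.coe_biUnion, Set.mem_iUnion, Set.coe_toFinset, Finset.mem_coe]
    have htop : ∀ i j, i ≠ j → s(i, j) ∈ (⊤ : SimpleGraph (Fin n)).edgeFinset := by simp
    have hedge : ∀ i j, W.model.Adj i j → u ∈ W.guard s(i, j) →
        ∃ e, ∃ (_ : e ∈ (⊤ : SimpleGraph (Fin n)).edgeFinset), u ∈ T e := by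
      intro i j hij hg
      refine ⟨s(i, j), htop i j hij.ne, ?_⟩
      simp only [T, mem_edgeSet, hij, if_true]
      exact ⟨hg, hreach⟩
    rcases W.cover u hu with ⟨i, hi⟩ | ⟨e, he, hue⟩
    · rcases W.branch_guard i u ⟨hi, hu⟩ with ⟨j, hji, hij⟩ | ⟨j, hij, hg⟩
      · refine ⟨s(i, j), htop i j hji.symm, ?_⟩
        simp only [T, mem_edgeSet, hij, if_false]
        exact ⟨hu, i, by simp, hi⟩
      · exact hedge i j hij hg
    · induction e using Sym2.ind with
      | _ i j => exact hedge i j he (W.link_guard _ he ⟨hue, hu⟩)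
  calc _ ≤ _ := Set.ncard_le_ncard hsub (Set.toFinite _)
    _ = _ := Set.ncard_coe_finset _
    _ ≤ _ := Finset.card_biUnion_le_card_mul _ _ _ hT
    _ = _ := by rw [card_edgeFinset_top_eq_card_choose_two, Fintype.card_fin]

end GuardedModel

/-! ### Making branch sets meet the boundary -/

namespace GuardedModel

variable {G : SimpleGraph V} {r n : ℕ} {R N D : Set V}

/-- A branch set without vertex of `N` can take one over from a linking path at it. -/
theorem exists_absorb (W : GuardedModel G r n R N D) {i j : Fin n} (hij : W.model.Adj i j)
    (hi : ¬ (W.branch i ∩ N).Nonempty) (hl : (W.link s(i, j) ∩ N).Nonempty) :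
    ∃ W' : GuardedModel G r n R N D, (∀ k, k ≠ i → W'.branch k = W.branch k) ∧
      (W'.branch i ∩ N).Nonempty := by
  classical
  obtain ⟨P₁, P₂, y, h₁, h₂, h₁₂, hP, hy, hconn, hlink⟩ := (W.linked i j hij).absorb (W.conn i) hl
  have he : s(i, j) ∈ W.model.edgeSet := hij
  have hinter : (W.branch i ∪ P₁) ∩ N = {y} := by
    rw [Set.union_inter_distrib_right, hy, Set.not_nonempty_iff_eq_empty.1 hi, Set.empty_union]
  have hyN : y ∈ P₁ ∩ N := hy ▸ rfl
  have hlinksub : ∀ e, Function.update W.link s(i, j) P₂ e ⊆ W.link e := by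
    intro e
    rcases eq_or_ne e s(i, j) with rfl | h
    · simpa using h₂
    · simp [h]
  have hbranchsup : ∀ k, W.branch k ⊆ Function.update W.branch i (W.branch i ∪ P₁) k := by
    intro k
    rcases eq_or_ne k i with rfl | h
    · simp
    · simp [h]
  refine ⟨{ W with
      branch := Function.update W.branch i (W.branch i ∪ P₁)
      link := Function.update W.link s(i, j) P₂
      conn := ?_
      disjoint_branch := ?_
      disjoint_branch_link := ?_
      disjoint_link := ?_
      branch_disjoint := ?_
      link_disjoint := ?_
      linked := ?_
      branch_subsingleton := ?_
      cover := ?_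
      link_guard := ?_
      branch_guard := ?_ }, ?_, ?_⟩
  · intro k
    rcases eq_or_ne k i with rfl | h
    · simpa using hconn
    · simpa [h] using W.conn k
  · have key : ∀ k, k ≠ i → Disjoint (W.branch i ∪ P₁) (W.branch k) := fun k hk =>
      Set.disjoint_union_left.2 ⟨W.disjoint_branch i k hk.symm,
        ((W.disjoint_branch_link k _ he).mono_right h₁).symm⟩
    intro a b hab
    rcases eq_or_ne a i with rfl | ha
    · simpa [hab.symm] using key b hab.symm
    · rcases eq_or_ne b i with rfl | hb
      · simpa [ha] using (key a ha).symm
      · simpa [ha, hb] using W.disjoint_branch a b hab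
  · intro k e hk
    rcases eq_or_ne k i with rfl | h
    · rw [Function.update_self]
      refine Set.disjoint_union_left.2
        ⟨(W.disjoint_branch_link k e hk).mono_right (hlinksub e), ?_⟩
      rcases eq_or_ne e s(k, j) with rfl | h
      · simpa using h₁₂
      · simpa [h] using (W.disjoint_link _ he e hk h.symm).mono_left h₁
    · rw [Function.update_of_ne h]
      exact (W.disjoint_branch_link k e hk).mono_right (hlinksub e)
  · exact fun e he e' he' hne =>
      (W.disjoint_link e he e' he' hne).mono (hlinksub e) (hlinksub e')
  · intro k
    rcases eq_or_ne k i with rfl | h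
    · simpa using ⟨W.branch_disjoint k, (W.link_disjoint _ he).mono_left h₁⟩
    · simpa [h] using W.branch_disjoint k
  · exact fun e he => (W.link_disjoint e he).mono_left (hlinksub e)
  · intro a b hab
    by_cases h : s(a, b) = s(i, j)
    · rw [h, Function.update_self]
      rcases Sym2.eq_iff.1 h with ⟨rfl, rfl⟩ | ⟨rfl, rfl⟩
      · simpa [hij.ne.symm] using hlink
      · simpa [hij.ne.symm] using hlink.symm
    · rw [Function.update_of_ne h]
      exact (W.linked a b hab).mono (hbranchsup a) (hbranchsup b)
  · intro k
    rcases eq_or_ne k i with rfl | h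
    · rw [Function.update_self, hinter]
      exact Set.subsingleton_singleton
    · simpa [h] using W.branch_subsingleton k
  · intro u hu
    rcases W.cover u hu with ⟨k, hk⟩ | ⟨e, he, hue⟩
    · exact Or.inl ⟨k, hbranchsup k hk⟩
    · rcases eq_or_ne e s(i, j) with rfl | h
      · rcases hP hue with h | h
        · exact Or.inl ⟨i, by simp [h]⟩
        · exact Or.inr ⟨_, he, by simpa using h⟩
      · exact Or.inr ⟨e, he, by simpa [h] using hue⟩
  · exact fun e he => (Set.inter_subset_inter_left _ (hlinksub e)).trans (W.link_guard e he)
  · intro k u hu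
    rcases eq_or_ne k i with rfl | h
    · rw [Function.update_self, hinter] at hu
      obtain rfl : u = y := hu
      exact Or.inr ⟨j, hij, W.link_guard _ he ⟨h₁ hyN.1, hyN.2⟩⟩
    · rw [Function.update_of_ne h] at hu
      exact W.branch_guard k u hu
  · intro k hk
    simp [hk]
  · simp [hinter]

/-- A vertex `i` whose branch set and linking paths avoid `N` can be taken out of use. Every other
vertex then has the non-neighbour `i`, so its branch set no longer needs a guard. -/
theorem exists_drop (W : GuardedModel G r n R N D) {i : Fin n}
    (hi : ¬ (W.branch i ∩ N).Nonempty)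
    (hl : ∀ j, W.model.Adj i j → ¬ (W.link s(i, j) ∩ N).Nonempty) :
    ∃ W' : GuardedModel G r n R N D, (∀ k, k ≠ i → W'.branch k = W.branch k) ∧
      W'.branch i = ∅ := by
  classical
  let M : SimpleGraph (Fin n) :=
    { Adj := fun a b => W.model.Adj a b ∧ a ≠ i ∧ b ≠ i
      symm := ⟨fun a b h => ⟨h.1.symm, h.2.2, h.2.1⟩⟩
      loopless := ⟨fun a h => W.model.loopless.irrefl a h.1⟩ }
  have hM : ∀ e ∈ M.edgeSet, e ∈ W.model.edgeSet := by
    intro e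
    induction e using Sym2.ind with
    | _ a b => exact fun h => h.1
  have hsub : ∀ k, Function.update W.branch i ∅ k ⊆ W.branch k := by
    intro k
    rcases eq_or_ne k i with rfl | h
    · simp
    · simp [h]
  refine ⟨{ W with
      branch := Function.update W.branch i ∅
      model := M
      conn := ?_
      disjoint_branch := fun a b hab => (W.disjoint_branch a b hab).mono (hsub a) (hsub b)
      disjoint_branch_link := fun k e he =>
        (W.disjoint_branch_link k e (hM e he)).mono_left (hsub k)
      disjoint_link := fun e he e' he' => W.disjoint_link e (hM e he) e' (hM e' he')
      branch_disjoint := fun k => (W.branch_disjoint k).mono_left (hsub k)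
      link_disjoint := fun e he => W.link_disjoint e (hM e he)
      linked := ?_
      branch_subsingleton := fun k =>
        (W.branch_subsingleton k).anti (Set.inter_subset_inter_left _ (hsub k))
      cover := ?_
      link_guard := fun e he => W.link_guard e (hM e he)
      branch_guard := ?_
      spread := fun e he => W.spread e (hM e he) }, ?_, ?_⟩
  · intro k
    rcases eq_or_ne k i with rfl | h
    · simpa using connIn_empty G
    · simpa [h] using W.conn k
  · intro a b hab
    simpa [hab.2.1, hab.2.2] using W.linked a b hab.1
  · intro u hu
    rcases W.cover u hu with ⟨k, hk⟩ | ⟨e, he, hue⟩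
    · have hki : k ≠ i := by
        rintro rfl
        exact hi ⟨u, hk, hu⟩
      exact Or.inl ⟨k, by simpa [hki] using hk⟩
    · refine Or.inr ⟨e, ?_, hue⟩
      induction e using Sym2.ind with
      | _ a b =>
        refine ⟨he, ?_, ?_⟩
        · rintro rfl
          exact hl b he ⟨u, hue, hu⟩
        · rintro rfl
          exact hl a he.symm ⟨u, by rwa [Sym2.eq_swap], hu⟩
  · intro k u hu
    rcases eq_or_ne k i with rfl | h
    · simp at hu
    · exact Or.inl ⟨i, h.symm, fun h => h.2.2 rfl⟩
  · intro k hk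
    simp [hk]
  · simp

/-- A model can be changed so that every non-empty branch set meets `N`: each one that does not either
absorbs part of a linking path or is dropped. -/
theorem exists_attached (W : GuardedModel G r n R N D) :
    ∃ W' : GuardedModel G r n R N D,
      ∀ i, (W'.branch i).Nonempty → (W'.branch i ∩ N).Nonempty := by
  induction h : {i | (W.branch i).Nonempty ∧ ¬ (W.branch i ∩ N).Nonempty}.ncard using
    Nat.strong_induction_on generalizing W with
  | _ m ih =>
    by_cases hW : ∀ i, (W.branch i).Nonempty → (W.branch i ∩ N).Nonempty
    · exact ⟨W, hW⟩
    push Not at hW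
    obtain ⟨i, hne, hi⟩ := hW
    rw [← Set.not_nonempty_iff_eq_empty] at hi
    have next : ∀ W' : GuardedModel G r n R N D, (∀ k, k ≠ i → W'.branch k = W.branch k) →
        ((W'.branch i).Nonempty → (W'.branch i ∩ N).Nonempty) →
        ∃ W' : GuardedModel G r n R N D,
          ∀ i, (W'.branch i).Nonempty → (W'.branch i ∩ N).Nonempty := by
      intro W' hk hi'
      refine ih _ ?_ W' rfl
      rw [← h]
      refine Set.ncard_lt_ncard ⟨?_, fun hs => (hs ⟨hne, hi⟩).2 (hi' (hs ⟨hne, hi⟩).1)⟩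
        (Set.toFinite _)
      rintro k ⟨hk1, hk2⟩
      have hki : k ≠ i := by
        rintro rfl
        exact hk2 (hi' hk1)
      rw [hk k hki] at hk1 hk2
      exact ⟨hk1, hk2⟩
    by_cases hl : ∃ j, W.model.Adj i j ∧ (W.link s(i, j) ∩ N).Nonempty
    · obtain ⟨j, hij, hj⟩ := hl
      obtain ⟨W', hk, hi'⟩ := W.exists_absorb hij hi hj
      exact next W' hk fun _ => hi'
    · push Not at hl
      obtain ⟨W', hk, hi'⟩ := W.exists_drop hi
        fun j hij => Set.not_nonempty_iff_eq_empty.2 (hl j hij)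
      exact next W' hk fun h => by simp [hi'] at h

end GuardedModel

/-! ### Extending a model into the territory -/

/-- The vertices outside `C` with a neighbour in `C`. -/
def outerBoundary (G : SimpleGraph V) (C : Set V) : Set V := {u | u ∉ C ∧ ∃ c ∈ C, G.Adj u c}

namespace GuardedModel

variable {G : SimpleGraph V} {r n : ℕ} {R N D : Set V}

/-- A single vertex of the territory can become the branch set of an unused vertex `i`. It needs no
guard, since `2 ≤ n` provides a non-neighbour of `i`. -/
theorem nonempty_addVertex (hn : 2 ≤ n) (W : GuardedModel G r n R N D) {i : Fin n}
    (hi : W.branch i = ∅) {v : V} (hv : v ∈ D) :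
    Nonempty (GuardedModel G r n R (N ∪ {v}) (D \ {v})) := by
  classical
  have hadj : ∀ j, ¬ W.model.Adj i j := fun j hij => by
    simpa [hi] using W.branch_nonempty hij
  have hvb : ∀ k, v ∉ W.branch k := fun k hk => Set.disjoint_left.1 (W.branch_disjoint k) hk hv
  have hvl : ∀ e ∈ W.model.edgeSet, v ∉ W.link e := fun e he hk =>
    Set.disjoint_left.1 (W.link_disjoint e he) hk hv
  have hsup : ∀ k, W.branch k ⊆ Function.update W.branch i {v} k := by
    intro k
    rcases eq_or_ne k i with rfl | h
    · simp [hi]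
    · simp [h]
  refine ⟨{ W with
      branch := Function.update W.branch i {v}
      conn := ?_
      disjoint_branch := ?_
      disjoint_branch_link := ?_
      branch_disjoint := ?_
      link_disjoint := fun e he => (W.link_disjoint e he).mono_right Set.sdiff_subset
      linked := fun a b hab => (W.linked a b hab).mono (hsup a) (hsup b)
      branch_subsingleton := ?_
      cover := ?_
      link_guard := ?_
      branch_guard := ?_ }⟩
  · intro k
    rcases eq_or_ne k i with rfl | h
    · simpa using connIn_singleton G v
    · simpa [h] using W.conn k
  · intro a b hab
    rcases eq_or_ne a i with rfl | ha
    · simpa [hab.symm] using hvb b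
    · rcases eq_or_ne b i with rfl | hb
      · simpa [ha] using hvb a
      · simpa [ha, hb] using W.disjoint_branch a b hab
  · intro k e he
    rcases eq_or_ne k i with rfl | h
    · simpa using hvl e he
    · simpa [h] using W.disjoint_branch_link k e he
  · intro k
    rcases eq_or_ne k i with rfl | h
    · simp
    · simpa [h] using (W.branch_disjoint k).mono_right Set.sdiff_subset
  · intro k
    rcases eq_or_ne k i with rfl | h
    · rw [Function.update_self]
      exact Set.subsingleton_singleton.anti Set.inter_subset_left
    · rw [Function.update_of_ne h]
      refine (W.branch_subsingleton k).anti ?_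
      rintro u ⟨hu, hN | rfl⟩
      exacts [⟨hu, hN⟩, (hvb k hu).elim]
  · rintro u (hu | rfl)
    · rcases W.cover u hu with ⟨k, hk⟩ | h
      · exact Or.inl ⟨k, hsup k hk⟩
      · exact Or.inr h
    · exact Or.inl ⟨i, by simp⟩
  · rintro e he u ⟨hu, hN | rfl⟩
    exacts [W.link_guard e he ⟨hu, hN⟩, (hvl e he hu).elim]
  · rintro k u ⟨hu, hN⟩
    rcases eq_or_ne k i with rfl | h
    · have : Nontrivial (Fin n) := Fin.nontrivial_iff_two_le.2 hn
      obtain ⟨j, hj⟩ := exists_ne k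
      exact Or.inl ⟨j, hj, hadj j⟩
    · rw [Function.update_of_ne h] at hu
      rcases hN with hN | rfl
      exacts [W.branch_guard k u ⟨hu, hN⟩, (hvb k hu).elim]

/-- A path through the territory between the boundary vertices of two branch sets not yet linked can
become a new linking path. It guards the two boundary vertices as well. -/
theorem nonempty_addPath (W : GuardedModel G r n R N D) {i j : Fin n} (hij : i ≠ j)
    (hadj : ¬ W.model.Adj i j) {y z : V} (hy : y ∈ W.branch i ∩ N) (hz : z ∈ W.branch j ∩ N)
    {l : List V} (hl : l.Nodup) (hlD : ∀ w ∈ l, w ∈ D)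
    (hc : List.IsChain G.Adj (y :: (l ++ [z])))
    (hspread : ∀ x ∈ R, {u | u ∈ y :: (l ++ [z]) ∧ ReachThrough G R r x u}.ncard ≤ 2 * r + 1) :
    Nonempty (GuardedModel G r n R (N ∪ {w | w ∈ l}) (D \ {w | w ∈ l})) := by
  classical
  have hne : ∀ e ∈ W.model.edgeSet, e ≠ s(i, j) := by
    rintro e he rfl
    exact hadj he
  have hvb : ∀ k, ∀ v ∈ l, v ∉ W.branch k := fun k v hv hk =>
    Set.disjoint_left.1 (W.branch_disjoint k) hk (hlD v hv)
  have hvl : ∀ e ∈ W.model.edgeSet, ∀ v ∈ l, v ∉ W.link e := fun e he v hv hk =>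
    Set.disjoint_left.1 (W.link_disjoint e he) hk (hlD v hv)
  let M : SimpleGraph (Fin n) := W.model ⊔ SimpleGraph.edge i j
  have hMi : M.Adj i j := Or.inr (by simp [SimpleGraph.edge_adj, hij])
  have hM : ∀ e ∈ M.edgeSet, e ∈ W.model.edgeSet ∨ e = s(i, j) := by
    intro e he
    rw [SimpleGraph.edgeSet_sup, SimpleGraph.edgeSet_edge_of_ne hij] at he
    exact he
  have hbr : ∀ k u, u ∈ W.branch k ∩ (N ∪ {w | w ∈ l}) → u ∈ W.branch k ∩ N := by
    rintro k u ⟨hu, hN | h⟩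
    exacts [⟨hu, hN⟩, (hvb k u h hu).elim]
  refine ⟨{ W with
      model := M
      link := Function.update W.link s(i, j) {w | w ∈ l}
      guard := Function.update W.guard s(i, j) {w | w ∈ y :: (l ++ [z])}
      disjoint_branch_link := ?_
      disjoint_link := ?_
      branch_disjoint := fun k => (W.branch_disjoint k).mono_right Set.sdiff_subset
      link_disjoint := ?_
      linked := ?_
      branch_subsingleton := fun k => (W.branch_subsingleton k).anti (hbr k)
      cover := ?_
      link_guard := ?_
      branch_guard := ?_
      spread := ?_ }⟩
  · intro k e he
    rcases hM e he with he | rfl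
    · simpa [hne e he] using W.disjoint_branch_link k e he
    · rw [Function.update_self, Set.disjoint_right]
      exact hvb k
  · intro e he e' he' h
    rcases hM e he with he | rfl <;> rcases hM e' he' with he' | rfl
    · simpa [hne e he, hne e' he'] using W.disjoint_link e he e' he' h
    · rw [Function.update_self, Function.update_of_ne h, Set.disjoint_right]
      exact hvl e he
    · rw [Function.update_self, Function.update_of_ne h.symm, Set.disjoint_left]
      exact hvl e' he'
    · exact (h rfl).elim
  · intro e he
    rcases hM e he with he | rfl
    · simpa [hne e he] using (W.link_disjoint e he).mono_right Set.sdiff_subset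
    · rw [Function.update_self]
      exact Set.disjoint_sdiff_right
  · intro a b hab
    have hlink : Linked G (W.branch i) (W.branch j) {w | w ∈ l} :=
      ⟨y, hy.1, z, hz.1, l, hl, rfl, hc⟩
    by_cases h : s(a, b) = s(i, j)
    · rw [h, Function.update_self]
      rcases Sym2.eq_iff.1 h with ⟨rfl, rfl⟩ | ⟨rfl, rfl⟩
      exacts [hlink, hlink.symm]
    · rw [Function.update_of_ne h]
      exact W.linked a b ((hM s(a, b) hab).resolve_right h)
  · rintro u (hu | hu)
    · rcases W.cover u hu with h | ⟨e, he, hue⟩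
      · exact Or.inl h
      · exact Or.inr ⟨e, SimpleGraph.edgeSet_mono le_sup_left he, by simpa [hne e he] using hue⟩
    · exact Or.inr ⟨s(i, j), hMi, by simpa using hu⟩
  · rintro e he u ⟨hu, hN⟩
    rcases hM e he with he | rfl
    · rw [Function.update_of_ne (hne e he)] at hu ⊢
      rcases hN with hN | h
      exacts [W.link_guard e he ⟨hu, hN⟩, (hvl e he u h hu).elim]
    · rw [Function.update_self] at hu ⊢
      exact List.mem_cons_of_mem _ (List.mem_append_left _ hu)
  · intro k u hu
    have hu' := hbr k u hu
    rcases eq_or_ne k i with rfl | hki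
    · obtain rfl := W.branch_subsingleton k hu' hy
      exact Or.inr ⟨j, hMi, by simp⟩
    rcases eq_or_ne k j with rfl | hkj
    · obtain rfl := W.branch_subsingleton k hu' hz
      exact Or.inr ⟨i, hMi.symm, by rw [Sym2.eq_swap, Function.update_self]; simp⟩
    rcases W.branch_guard k u hu' with ⟨m, hm, hkm⟩ | ⟨m, hkm, hg⟩
    · refine Or.inl ⟨m, hm, fun h => ?_⟩
      rcases hM s(k, m) h with h | h
      · exact hkm h
      · rcases Sym2.eq_iff.1 h with ⟨h, -⟩ | ⟨h, -⟩
        exacts [hki h, hkj h]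
    · exact Or.inr ⟨m, Or.inl hkm, by rwa [Function.update_of_ne (hne _ hkm)]⟩
  · intro e he x hx
    rcases hM e he with he | rfl
    · simpa [hne e he] using W.spread e he x hx
    · simpa using hspread x hx

/-- If the model is complete and all branch sets meet the boundary, then the branch sets, each with
the linking paths to larger indices, and the territory itself form a complete minor on `n + 1`
vertices. -/
theorem isMinorOf_of_model_eq_top {C : Set V} (hC : ConnIn G C) (hne : C.Nonempty)
    (W : GuardedModel G r n R (outerBoundary G C) C) (htop : ∀ i j, i ≠ j → W.model.Adj i j)
    (hatt : ∀ i, (W.branch i ∩ outerBoundary G C).Nonempty) :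
    (completeGraph (Fin (n + 1))).IsMinorOf G := by
  let A : Fin n → Set V := fun i => W.branch i ∪ {u | ∃ j, i < j ∧ u ∈ W.link s(i, j)}
  have hA : ∀ i, ConnIn G (A i) := by
    intro i
    refine (W.conn i).of_base Set.subset_union_left ?_
    rintro x (hx | ⟨j, hij, hx⟩)
    · obtain ⟨p, hp⟩ := W.conn i x hx x hx
      exact ⟨x, hx, p, fun w hw => Or.inl (hp w hw)⟩
    · exact (W.linked i j (htop i j hij.ne)).exists_walk (S := A i)
        Set.subset_union_left (fun w hw => Or.inr ⟨j, hij, hw⟩) x hx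
  have hAC : ∀ i, Disjoint (A i) C := by
    intro i
    rw [Set.disjoint_left]
    rintro u (hu | ⟨j, hij, hu⟩)
    · exact Set.disjoint_left.1 (W.branch_disjoint i) hu
    · exact Set.disjoint_left.1 (W.link_disjoint _ (htop i j hij.ne)) hu
  have hAA : ∀ i j, i < j → Disjoint (A i) (A j) := by
    intro i j hij
    rw [Set.disjoint_left]
    rintro u (hu | ⟨a, ha, hu⟩) (hu' | ⟨b, hb, hu'⟩)
    · exact Set.disjoint_left.1 (W.disjoint_branch i j hij.ne) hu hu'
    · exact Set.disjoint_left.1 (W.disjoint_branch_link i _ (htop j b hb.ne)) hu hu'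
    · exact Set.disjoint_left.1 (W.disjoint_branch_link j _ (htop i a ha.ne)) hu' hu
    · refine Set.disjoint_left.1 (W.disjoint_link _ (htop i a ha.ne) _ (htop j b hb.ne) ?_) hu hu'
      intro h
      rcases Sym2.eq_iff.1 h with ⟨h, -⟩ | ⟨rfl, rfl⟩
      · exact hij.ne h
      · exact lt_asymm hij hb
  have hAadj : ∀ i j, i < j → ∃ u ∈ A i, ∃ v ∈ A j, G.Adj u v := by
    intro i j hij
    obtain ⟨u, hu, v, hv, huv⟩ := (W.linked i j (htop i j hij.ne)).exists_adj
    refine ⟨u, ?_, v, Or.inl hv, huv⟩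
    rcases hu with hu | hu
    exacts [Or.inl hu, Or.inr ⟨j, hij, hu⟩]
  have hCadj : ∀ i, ∃ u ∈ C, ∃ v ∈ A i, G.Adj u v := by
    intro i
    obtain ⟨v, hv, -, c, hc, hvc⟩ := hatt i
    exact ⟨c, hc, v, Or.inl hv, hvc.symm⟩
  refine ⟨Fin.cons ((⊤ : G.Subgraph).induce C) fun i => (⊤ : G.Subgraph).induce (A i), ?_, ?_, ?_⟩
  · refine Fin.cases (hC.subgraph_connected hne) fun i => (hA i).subgraph_connected ?_
    exact (hatt i).mono fun u hu => Or.inl hu.1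
  · refine Fin.cases (Fin.cases (fun h => (h rfl).elim) fun j _ => (hAC j).symm) fun i =>
      Fin.cases (fun _ => hAC i) fun j hij => ?_
    rcases lt_or_gt_of_ne (fun h => hij (congrArg Fin.succ h) : i ≠ j) with h | h
    exacts [hAA i j h, (hAA j i h).symm]
  · have symm : ∀ {S T : Set V}, (∃ u ∈ S, ∃ v ∈ T, G.Adj u v) → ∃ u ∈ T, ∃ v ∈ S, G.Adj u v :=
      fun ⟨u, hu, v, hv, h⟩ => ⟨v, hv, u, hu, h.symm⟩
    refine Fin.cases (Fin.cases (fun h => (h rfl).elim) fun j _ => hCadj j) fun i =>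
      Fin.cases (fun _ => symm (hCadj i)) fun j hij => ?_
    rcases lt_or_gt_of_ne (fun h => hij (congrArg Fin.succ h) : i ≠ j) with h | h
    exacts [hAadj i j h, symm (hAadj j i h)]

/-- Part of a connected territory can be given up in such a way that the rest still has a model. -/
theorem exists_extend {C : Set V} (hn : 2 ≤ n) (hC : ConnIn G C) (hne : C.Nonempty)
    (hG : ¬ (completeGraph (Fin (n + 1))).IsMinorOf G)
    (W : GuardedModel G r n C (outerBoundary G C) C) :
    ∃ S ⊆ C, S.Nonempty ∧ Nonempty (GuardedModel G r n C (outerBoundary G C ∪ S) (C \ S)) := by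
  obtain ⟨W, hW⟩ := W.exists_attached
  by_cases hempty : ∃ i, W.branch i = ∅
  · obtain ⟨i, hi⟩ := hempty
    obtain ⟨v, hv⟩ := hne
    exact ⟨{v}, by simpa using hv, by simp, W.nonempty_addVertex hn hi hv⟩
  push Not at hempty
  have hatt := fun i => hW i (hempty i)
  by_cases htop : ∀ i j, i ≠ j → W.model.Adj i j
  · exact (hG (W.isMinorOf_of_model_eq_top hC hne htop hatt)).elim
  push Not at htop
  obtain ⟨i, j, hij, hadj⟩ := htop
  obtain ⟨y, hy⟩ := hatt i
  obtain ⟨z, hz⟩ := hatt j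
  have hyz : y ≠ z := by
    rintro rfl
    exact Set.disjoint_left.1 (W.disjoint_branch i j hij) hy.1 hz.1
  obtain ⟨l, hl0, hnd, hlC, hc, hs⟩ :=
    exists_geodesic_through hC hy.2.1 hz.2.1 hyz hy.2.2 hz.2.2 r
  obtain ⟨w, hw⟩ := List.exists_mem_of_ne_nil l hl0
  exact ⟨{w | w ∈ l}, hlC, ⟨w, hw⟩, W.nonempty_addPath hij hadj hy hz hnd hlC hc hs⟩

end GuardedModel

/-! ### Orderings of a territory -/

/-- The analogue of the strongly `r`-reachable set of `v` when only `C` is ordered, by the rank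
function `f`, and all vertices outside `C` precede those of `C`. -/
def backReach (G : SimpleGraph V) (r : ℕ) (C : Set V) (f : V → ℕ) (v : V) : Set V :=
  {u | (u ∈ C → f u ≤ f v) ∧ ∃ p : G.Walk v u, p.length ≤ r ∧
    ∀ w ∈ p.support, w ≠ v → w ≠ u → w ∈ C ∧ f v < f w}

/-- `C` can be ordered, after all vertices outside `C`, so that every backward reachable set has at
most `b` elements. -/
def HasOrdering (G : SimpleGraph V) (r b : ℕ) (C : Set V) : Prop :=
  ∃ f : V → ℕ, Set.InjOn f C ∧ ∀ v ∈ C, (backReach G r C f v).ncard ≤ b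

theorem exists_bound_of_finite [Finite V] (f : V → ℕ) : ∃ K, ∀ v, f v < K := by
  obtain ⟨K, hK⟩ := (Set.finite_range f).bddAbove
  exact ⟨K + 1, fun v => Nat.lt_succ_of_le (hK ⟨v, rfl⟩)⟩

/-- A walk through `C` that starts in `C₁` can be cut short, keeping its end, so that it runs through
`C₁`, if no edge leaves `C₁` within `C`. Cutting is needed only when the end `u` lies outside `C`
and is visited repeatedly. -/
theorem exists_walk_of_closed {G : SimpleGraph V} {C C₁ : Set V}
    (h : ∀ a ∈ C₁, ∀ b ∈ C, G.Adj a b → b ∈ C₁) {v u : V} (p : G.Walk v u) (hv : v ∈ C₁)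
    (hp : ∀ w ∈ p.support, w ≠ u → w ∈ C) :
    (u ∈ C → u ∈ C₁) ∧ ∃ q : G.Walk v u, q.length ≤ p.length ∧
      ∀ w ∈ q.support, w ∈ p.support ∧ (w ≠ u → w ∈ C₁) := by
  induction p with
  | nil =>
    refine ⟨fun _ => hv, Walk.nil, le_rfl, fun w hw => ⟨hw, fun hne => ?_⟩⟩
    exact (hne (by simpa using hw)).elim
  | @cons a b u hab p ih =>
    by_cases hb : b ∈ C₁
    · obtain ⟨hu, q, hq, hs⟩ := ih hb fun w hw hne => hp w (by simp [hw]) hne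
      refine ⟨hu, Walk.cons hab q, by simpa using hq, fun w hw => ?_⟩
      rw [Walk.support_cons, List.mem_cons] at hw
      rcases hw with rfl | hw
      · exact ⟨by simp, fun _ => hv⟩
      · exact ⟨by simp [(hs w hw).1], (hs w hw).2⟩
    · have hbC : b ∉ C := fun hbC => hb (h a hv b hbC hab)
      obtain rfl : b = u := by
        by_contra hne
        exact hbC (hp b (by simp) hne)
      refine ⟨fun h => (hbC h).elim, Walk.cons hab Walk.nil, by simp, fun w hw => ?_⟩
      simp only [Walk.support_cons, Walk.support_nil, List.mem_cons, List.not_mem_nil,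
        or_false] at hw
      rcases hw with rfl | rfl
      · exact ⟨by simp, fun _ => hv⟩
      · exact ⟨by simp, fun h => (h rfl).elim⟩

theorem injOn_ite_add {S C : Set V} [DecidablePred (· ∈ S)] {f g : V → ℕ} {K : ℕ}
    (hf : Set.InjOn f S) (hg : Set.InjOn g (C \ S)) (hK : ∀ v, f v < K) :
    Set.InjOn (fun v => if v ∈ S then f v else g v + K) C := by
  intro a ha b hb hab
  simp only at hab
  split_ifs at hab with h1 h2 h2
  · exact hf h1 h2 hab
  · have := hK a; omega
  · have := hK b; omega
  · exact hg ⟨ha, h1⟩ ⟨hb, h2⟩ (by omega)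

/-- Orderings of two parts of `C` without edges between them combine to an ordering of `C`. -/
theorem HasOrdering.of_separated [Finite V] {G : SimpleGraph V} {r b : ℕ} {C C₁ : Set V}
    (hC₁ : C₁ ⊆ C) (h : ∀ a ∈ C₁, ∀ b ∈ C \ C₁, ¬ G.Adj a b) (h₁ : HasOrdering G r b C₁)
    (h₂ : HasOrdering G r b (C \ C₁)) : HasOrdering G r b C := by
  classical
  obtain ⟨f, hf, hfb⟩ := h₁
  obtain ⟨g, hg, hgb⟩ := h₂
  obtain ⟨K, hK⟩ := exists_bound_of_finite f
  refine ⟨_, injOn_ite_add hf hg hK, fun v hv => ?_⟩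
  by_cases hv1 : v ∈ C₁
  · refine (Set.ncard_le_ncard ?_ (Set.toFinite _)).trans (hfb v hv1)
    rintro u ⟨hu, p, hp, hs⟩
    obtain ⟨-, q, hq, hqs⟩ := exists_walk_of_closed (C := C) (C₁ := C₁)
      (fun a ha b hb hab => by_contra fun hb1 => h a ha b ⟨hb, hb1⟩ hab) p hv1
      (fun w hw hne => by
        rcases eq_or_ne w v with rfl | hwv
        exacts [hv, (hs w hw hwv hne).1])
    refine ⟨fun hu1 => by simpa [hu1, hv1] using hu (hC₁ hu1), q, hq.trans hp, ?_⟩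
    intro w hw hwv hwu
    have hw1 := (hqs w hw).2 hwu
    exact ⟨hw1, by simpa [hw1, hv1] using (hs w (hqs w hw).1 hwv hwu).2⟩
  · refine (Set.ncard_le_ncard ?_ (Set.toFinite _)).trans (hgb v ⟨hv, hv1⟩)
    rintro u ⟨hu, p, hp, hs⟩
    obtain ⟨-, q, hq, hqs⟩ := exists_walk_of_closed (C := C) (C₁ := C \ C₁)
      (fun a ha b hb hab => ⟨hb, fun hb1 => h b hb1 a ha hab.symm⟩) p ⟨hv, hv1⟩
      (fun w hw hne => by
        rcases eq_or_ne w v with rfl | hwv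
        exacts [hv, (hs w hw hwv hne).1])
    refine ⟨fun hu1 => by simpa [hu1.2, hv1] using hu hu1.1, q, hq.trans hp, ?_⟩
    intro w hw hwv hwu
    have hw1 := (hqs w hw).2 hwu
    exact ⟨hw1, by simpa [hw1.2, hv1] using (hs w (hqs w hw).1 hwv hwu).2⟩

/-- An ordering of `C \ S` can be preceded by any ordering of `S`, if vertices of `S` reach few
vertices of `S` and of the boundary of `C` through `C`. -/
theorem HasOrdering.of_sdiff [Finite V] {G : SimpleGraph V} {r b : ℕ} {C S : Set V}
    (h : ∀ v ∈ S, {u | u ∈ outerBoundary G C ∪ S ∧ ReachThrough G C r v u}.ncard ≤ b)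
    (h₂ : HasOrdering G r b (C \ S)) : HasOrdering G r b C := by
  classical
  obtain ⟨g, hg, hgb⟩ := h₂
  obtain ⟨f, hf⟩ : ∃ f : V → ℕ, Function.Injective f := Countable.exists_injective_nat V
  obtain ⟨K, hK⟩ := exists_bound_of_finite f
  refine ⟨_, injOn_ite_add hf.injOn hg hK, fun v hv => ?_⟩
  by_cases hv1 : v ∈ S
  · refine (Set.ncard_le_ncard ?_ (Set.toFinite _)).trans (h v hv1)
    rintro u ⟨hu, p, hp, hs⟩
    have hsC : ∀ w ∈ p.support, w ≠ u → w ∈ C := fun w hw hne => by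
      rcases eq_or_ne w v with rfl | hwv
      exacts [hv, (hs w hw hwv hne).1]
    refine ⟨?_, p, hp, hsC⟩
    by_cases huC : u ∈ C
    · right
      by_contra huS
      have := hu huC
      simp only [huS, hv1, if_true, if_false] at this
      have := hK v
      omega
    · left
      have huv : v ≠ u := by
        rintro rfl
        exact huC hv
      have hnil : ¬ p.Nil := Walk.not_nil_of_ne huv
      refine ⟨huC, p.penultimate, hsC _ (p.getVert_mem_support _) ?_,
        (Walk.adj_penultimate hnil).symm⟩
      exact (Walk.adj_penultimate hnil).ne
  · refine (Set.ncard_le_ncard ?_ (Set.toFinite _)).trans (hgb v ⟨hv, hv1⟩)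
    rintro u ⟨hu, p, hp, hs⟩
    refine ⟨fun hu1 => by simpa [hu1.2, hv1] using hu hu1.1, p, hp, ?_⟩
    intro w hw hwv hwu
    obtain ⟨hwC, hlt⟩ := hs w hw hwv hwu
    by_cases hwS : w ∈ S
    · simp only [hwS, hv1, if_true, if_false] at hlt
      have := hK w
      omega
    · exact ⟨⟨hwC, hwS⟩, by simpa [hwS, hv1] using hlt⟩

theorem outerBoundary_subset_of_separated {G : SimpleGraph V} {C C₁ : Set V} (hC₁ : C₁ ⊆ C)
    (h : ∀ a ∈ C₁, ∀ b ∈ C \ C₁, ¬ G.Adj a b) : outerBoundary G C₁ ⊆ outerBoundary G C := by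
  rintro u ⟨hu, c, hc, huc⟩
  exact ⟨fun huC => h c hc u ⟨huC, hu⟩ huc.symm, c, hC₁ hc, huc⟩

theorem exists_separated_of_not_connIn {G : SimpleGraph V} {C : Set V} (hC : ¬ ConnIn G C) :
    ∃ C₁ ⊆ C, C₁.Nonempty ∧ (C \ C₁).Nonempty ∧ ∀ a ∈ C₁, ∀ b ∈ C \ C₁, ¬ G.Adj a b := by
  unfold ConnIn at hC
  push Not at hC
  obtain ⟨x, hx, y, hy, hxy⟩ := hC
  refine ⟨{z | z ∈ C ∧ ∃ p : G.Walk x z, ∀ w ∈ p.support, w ∈ C}, fun z hz => hz.1,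
    ⟨x, hx, Walk.nil, by simpa using hx⟩, ⟨y, hy, ?_⟩, ?_⟩
  · rintro ⟨-, p, hp⟩
    obtain ⟨w, hw, hwC⟩ := hxy p
    exact hwC (hp w hw)
  · rintro a ⟨ha, p, hp⟩ b ⟨hb, hb'⟩ hab
    refine hb' ⟨hb, p.concat hab, fun w hw => ?_⟩
    rw [Walk.support_concat] at hw
    simp only [List.mem_append, List.mem_singleton] at hw
    rcases hw with hw | rfl
    exacts [hp w hw, hb]

/-- Induction on the size of the territory `C`: a disconnected one is split, a connected one loses the
vertices that `exists_extend` adds to the model. -/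
theorem GuardedModel.hasOrdering [Finite V] {G : SimpleGraph V} {r n : ℕ} (hr : 1 ≤ r)
    (hn : 2 ≤ n) (hG : ¬ (completeGraph (Fin (n + 1))).IsMinorOf G) (C : Set V)
    (W : GuardedModel G r n C (outerBoundary G C) C) :
    HasOrdering G r (n.choose 2 * (2 * r + 1)) C := by
  induction h : C.ncard using Nat.strong_induction_on generalizing C with
  | _ m ih =>
    subst h
    rcases C.eq_empty_or_nonempty with rfl | hne
    · exact ⟨fun _ => 0, by simp, by simp⟩
    by_cases hC : ConnIn G C
    · obtain ⟨S, hSC, hSne, ⟨W'⟩⟩ := W.exists_extend hn hC hne hG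
      refine HasOrdering.of_sdiff (fun v hv => W'.ncard_reach_le hr (hSC hv)) ?_
      refine ih _ (Set.ncard_lt_ncard ?_ (Set.toFinite _)) _
        (W'.mono Set.sdiff_subset ?_ subset_rfl) rfl
      · exact ⟨Set.sdiff_subset, fun h => hSne.elim fun v hv => (h (hSC hv)).2 hv⟩
      · rintro u ⟨hu, c, hc, huc⟩
        by_cases huS : u ∈ S
        · exact Or.inr huS
        · exact Or.inl ⟨fun huC => hu ⟨huC, huS⟩, c, hc.1, huc⟩
    · obtain ⟨C₁, hC₁, ⟨a, ha⟩, ⟨b, hb⟩, hsep⟩ := exists_separated_of_not_connIn hC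
      refine HasOrdering.of_separated hC₁ hsep ?_ ?_
      · refine ih _ (Set.ncard_lt_ncard ⟨hC₁, fun h => hb.2 (h hb.1)⟩ (Set.toFinite _)) _
          (W.mono hC₁ (outerBoundary_subset_of_separated hC₁ hsep) hC₁) rfl
      · refine ih _ (Set.ncard_lt_ncard ⟨Set.sdiff_subset, fun h => (h (hC₁ ha)).2 ha⟩
          (Set.toFinite _)) _ (W.mono Set.sdiff_subset
            (outerBoundary_subset_of_separated Set.sdiff_subset ?_) Set.sdiff_subset) rfl
        rw [Set.sdiff_sdiff_cancel_left hC₁]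
        exact fun a ha b hb hab => hsep b hb a ha hab.symm

theorem HasOrdering.colouringNumber_le [Fintype V] {G : SimpleGraph V} {r b : ℕ}
    (h : HasOrdering G r b Set.univ) : G.colouringNumber r ≤ b := by
  obtain ⟨f, hf, hb⟩ := h
  let L : LinearOrder V := LinearOrder.lift' f (Set.injOn_univ.1 hf)
  refine (ciInf_le (OrderBot.bddBelow _) L).trans (Finset.sup_le fun v _ => ?_)
  refine (Set.ncard_le_ncard ?_ (Set.toFinite _)).trans (hb v trivial)
  rintro u ⟨hu, p, -, hp, hs⟩
  exact ⟨fun _ => hu, p, hp, fun w hw hwv hwu => ⟨trivial, hs w hw hwv hwu⟩⟩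

end Territory

theorem corollary1p3 {V : Type*} [Fintype V] (G : SimpleGraph V) (t r : ℕ)
    (ht : 3 ≤ t) (hr : 1 ≤ r)
    (hG : ¬ (SimpleGraph.completeGraph (Fin t)).IsMinorOf G) :
    G.colouringNumber r ≤ (t - 1).choose 2 * (2 * r + 1) := by
  obtain ⟨n, rfl⟩ : ∃ n, t = n + 1 := ⟨t - 1, by omega⟩
  have hn : 2 ≤ n := by omega
  have hbdry : outerBoundary G Set.univ ⊆ ∅ := fun u hu => (hu.1 trivial).elim
  have W := (GuardedModel.empty G r n Set.univ Set.univ).mono subset_rfl hbdry subset_rfl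
  exact (W.hasOrdering hr hn hG).colouringNumber_le
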